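/- Let $G$ be a countable (discrete) amenable group, i.e. there is a left-invariant mean on $\ell^\infty(G,\mathbb{R})$. A unitary representation $(H_\pi,\pi)$ of $G$ is a homomorphism $\pi$ from $G$ to the unitary group of a complex Hilbert space $H_\pi$. Let $\lambda_G$ be the left regular representation of $G$ on $\ell^2(G)$, $(\lambda_G(g)f)(h)=f(g^{-1}h)$, and let $(H_{\infty\lambda_G},\infty\lambda_G)$ be the Hilbert space direct sum of countably infinitely many copies of it. A representation $(H_\pi,\pi)$ is regarded as a two-sorted structure, with a sort for $H_\pi$ and a sort for the field $\mathbb{C}$. Vector terms are built from vector variables and $0$ by addition, multiplication by scalar terms and the operators $\pi(g)$, $g\in G$; scalar terms are built from scalar variables and rational constants by addition, multiplication, complex conjugation and the inner product of vector terms. Atomic formulas are $r(c)\le p$ and $r(c)\ge p$, where $c$ is a scalar term (for instance $\langle s,t\rangle$), $p$ is a rational number and $r$ is the real part, the imaginary part or the modulus. Quantifier-free (positive) formulas are obtained from atomic ones by conjunctions and disjunctions. An approximation $\varphi'$ of a quantifier-free formula $\varphi$ is obtained by replacing every atomic subformula $r(c)\le p$ by $r(c)\le p+\varepsilon$ and every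 $r(c)\ge p$ by $r(c)\ge p-\varepsilon$, with rational numbers $\varepsilon>0$ that may differ from one occurrence to another. The structure $(H_\pi,+,\langle\cdot,\cdot\rangle,\pi)$ is existentially closed (in approximate semantics) if for every unitary representation $(H_\eta,\eta)$ of $G$ extending $(H_\pi,\pi)$, every finite tuple $\bar v$ of parameters from $H_\pi$ and from $\mathbb{C}$, every quantifier-free formula $\varphi(\bar x,\bar y)$ such that $\exists\bar x\,\varphi(\bar x,\bar v)$ holds in $(H_\eta,\eta)$, and every approximation $\varphi'$ of $\varphi$, the formula $\exists\bar x\,\varphi'(\bar x,\bar v)$ holds in $(H_\pi,\pi)$. Then for every unitary representation $(H_\pi,\pi)$ of $G$ the structure $$(H_\pi\oplus H_{\infty\lambda_G},+,\langle\cdot,\cdot\rangle,\pi\oplus\infty\lambda_G)$$ is existentially closed. In particular, $(H_{\infty\lambda_G},+,\langle\cdot,\cdot\rangle,\infty\lambda_G)$ is existentially closed. -/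

import Mathlib

open scoped ENNReal

universe u v w

noncomputable section

/-- A discrete group is amenable if there is a left-invariant mean on the bounded real-valued
functions on it: a positive, normalized, left-invariant linear functional on `ℓ^∞(G, ℝ)`. -/
def IsAmenableGroup (G : Type u) [Group G] : Prop :=
  ∃ m : lp (fun _ : G => ℝ) ∞ →ₗ[ℝ] ℝ,
    m 1 = 1 ∧
    (∀ f : lp (fun _ : G => ℝ) ∞, (∀ h, 0 ≤ f h) → 0 ≤ m f) ∧
    (∀ (g : G) (f f' : lp (fun _ : G => ℝ) ∞), (∀ h, f' h = f (g⁻¹ * h)) → m f' = m f)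

/-- A unitary representation of `G` on `H`: a homomorphism from `G` to the group of unitary
operators (surjective linear isometries) of `H`. -/
abbrev UnitaryRep (G : Type u) [Group G] (H : Type v) [NormedAddCommGroup H]
    [InnerProductSpace ℂ H] : Type (max u v) :=
  G →* (H ≃ₗᵢ[ℂ] H)

namespace UnitaryRep

/-- The coordinatewise action of a family of linear isometric automorphisms on the Hilbert sum. -/
def lpMap {I : Type v} {E : I → Type w} [∀ i, NormedAddCommGroup (E i)]
    [∀ i, InnerProductSpace ℂ (E i)] (T : ∀ i, E i ≃ₗᵢ[ℂ] E i) : lp E 2 ≃ₗᵢ[ℂ] lp E 2 where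
  toFun f := ⟨fun i => T i (f i), memℓp_gen (by simpa using lp.memℓp f |>.summable (by simp))⟩
  invFun f :=
    ⟨fun i => (T i).symm (f i), memℓp_gen (by simpa using lp.memℓp f |>.summable (by simp))⟩
  map_add' f g := by ext i; simp; rfl
  map_smul' c f := by ext i; simp
  left_inv f := by ext i; simp
  right_inv f := by ext i; simp
  norm_map' f := by
    have h2 : 0 < (2 : ℝ≥0∞).toReal := by simp
    simp [lp.norm_eq_tsum_rpow h2]

/-- The direct sum of a family of unitary representations, on the Hilbert space direct sum. -/
def directSum {G : Type u} [Group G] {I : Type v} {E : I → Type w}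
    [∀ i, NormedAddCommGroup (E i)] [∀ i, InnerProductSpace ℂ (E i)]
    (π : ∀ i, UnitaryRep G (E i)) : UnitaryRep G (lp E 2) where
  toFun g := lpMap fun i => π i g
  map_one' := by ext f i; simp [lpMap]
  map_mul' g h := by ext f i; simp [lpMap]

/-- The direct sum of countably infinitely many copies of a unitary representation. -/
def infiniteSum {G : Type u} [Group G] {H : Type v} [NormedAddCommGroup H]
    [InnerProductSpace ℂ H] (π : UnitaryRep G H) : UnitaryRep G (lp (fun _ : ℕ => H) 2) :=
  directSum fun _ => π

/-- The direct sum of two unitary representations. -/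
def prod {G : Type u} [Group G] {H : Type v} {K : Type w}
    [NormedAddCommGroup H] [InnerProductSpace ℂ H] [NormedAddCommGroup K] [InnerProductSpace ℂ K]
    (π : UnitaryRep G H) (ρ : UnitaryRep G K) : UnitaryRep G (WithLp 2 (H × K)) where
  toFun g := LinearIsometryEquiv.withLpProdCongr 2 (π g) (ρ g)
  map_one' := by ext x; simp [LinearIsometryEquiv.withLpProdCongr]; rfl
  map_mul' g h := by ext x; simp [LinearIsometryEquiv.withLpProdCongr]; rfl

/-- Reindexing of `ℓ²(I)` along a permutation of `I`: the function `f` goes to `f ∘ e`. -/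
def lpReindex {I : Type u} (e : I ≃ I) :
    lp (fun _ : I => ℂ) 2 ≃ₗᵢ[ℂ] lp (fun _ : I => ℂ) 2 where
  toFun f := ⟨fun i => f (e i),
    memℓp_gen ((e.summable_iff (f := fun i => ‖f i‖ ^ (2 : ℝ≥0∞).toReal)).2
      ((lp.memℓp f).summable (by simp)))⟩
  invFun f := ⟨fun i => f (e.symm i),
    memℓp_gen ((e.symm.summable_iff (f := fun i => ‖f i‖ ^ (2 : ℝ≥0∞).toReal)).2
      ((lp.memℓp f).summable (by simp)))⟩
  map_add' f g := by ext i; simp; rfl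
  map_smul' c f := by ext i; simp
  left_inv f := by ext i; simp
  right_inv f := by ext i; simp
  norm_map' f := by
    have h2 : 0 < (2 : ℝ≥0∞).toReal := by simp
    rw [lp.norm_eq_tsum_rpow h2, lp.norm_eq_tsum_rpow h2]
    congr 1
    exact e.tsum_eq fun i => ‖f i‖ ^ (2 : ℝ≥0∞).toReal

/-- The (left) regular representation on `ℓ²(G)`: `(λ(g) f)(h) = f (g⁻¹ h)`. -/
def regular (G : Type u) [Group G] : UnitaryRep G (lp (fun _ : G => ℂ) 2) where
  toFun g := lpReindex (Equiv.mulLeft g⁻¹)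
  map_one' := by ext f i; simp [lpReindex]
  map_mul' g h := by ext f i; simp [lpReindex, mul_assoc]

end UnitaryRep

/-- The two sorts of the language: vectors and complex scalars. -/
inductive HSort : Type
  | vec : HSort
  | scal : HSort

/-- Terms of the two-sorted language of Hilbert spaces with an action of `G`. Here `V` and `S`
are the sets of variables of the sorts of vectors and of scalars. -/
inductive RepTerm (G : Type u) (V S : Type) : HSort → Type u
  | vecVar (x : V) : RepTerm G V S HSort.vec
  | zero : RepTerm G V S HSort.vec
  | vecAdd (s t : RepTerm G V S HSort.vec) : RepTerm G V S HSort.vec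
  | smul (c : RepTerm G V S HSort.scal) (s : RepTerm G V S HSort.vec) : RepTerm G V S HSort.vec
  | act (g : G) (s : RepTerm G V S HSort.vec) : RepTerm G V S HSort.vec
  | scalVar (a : S) : RepTerm G V S HSort.scal
  | const (q : ℚ) : RepTerm G V S HSort.scal
  | scalAdd (c d : RepTerm G V S HSort.scal) : RepTerm G V S HSort.scal
  | mul (c d : RepTerm G V S HSort.scal) : RepTerm G V S HSort.scal
  | conj (c : RepTerm G V S HSort.scal) : RepTerm G V S HSort.scal
  | inner (s t : RepTerm G V S HSort.vec) : RepTerm G V S HSort.scal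

/-- The interpretation of the two sorts in a Hilbert space `H`. -/
abbrev HSort.carrier (H : Type v) : HSort → Type v
  | HSort.vec => H
  | HSort.scal => ULift.{v} ℂ

namespace RepTerm

/-- The value of a term in the structure given by a unitary representation. -/
def eval {G : Type u} [Group G] {H : Type v} [NormedAddCommGroup H] [InnerProductSpace ℂ H]
    (π : UnitaryRep G H) {V S : Type} (x : V → H) (a : S → ℂ) :
    ∀ {σ : HSort}, RepTerm G V S σ → HSort.carrier H σ
  | _, vecVar i => x i
  | _, zero => (0 : H)
  | _, vecAdd s t => (eval π x a s + eval π x a t : H)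
  | _, smul c s => ((eval π x a c).down • eval π x a s : H)
  | _, act g s => π g (eval π x a s)
  | _, scalVar i => ULift.up (a i)
  | _, const q => ULift.up (q : ℂ)
  | _, scalAdd c d => ULift.up ((eval π x a c).down + (eval π x a d).down)
  | _, mul c d => ULift.up ((eval π x a c).down * (eval π x a d).down)
  | _, conj c => ULift.up (starRingEnd ℂ (eval π x a c).down)
  | _, inner s t => ULift.up (Inner.inner ℂ (eval π x a s : H) (eval π x a t : H))

end RepTerm

/-- The three real quantities attached to a complex number that are compared with rationals. -/
inductive RealPart : Type
  | re : RealPart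
  | im : RealPart
  | abs : RealPart

/-- The real part, the imaginary part, or the modulus of a complex number. -/
def RealPart.eval : RealPart → ℂ → ℝ
  | RealPart.re, z => z.re
  | RealPart.im, z => z.im
  | RealPart.abs, z => ‖z‖

/-- Quantifier-free positive formulas: the closure of the atomic formulas `c ≤ p` and `c ≥ p`
(for the real part, the imaginary part or the modulus of a scalar term `c`, and `p` rational)
under conjunction and disjunction. -/
inductive QFFormula (G : Type u) (V S : Type) : Type u
  | le (r : RealPart) (c : RepTerm G V S HSort.scal) (p : ℚ) : QFFormula G V S
  | ge (r : RealPart) (c : RepTerm G V S HSort.scal) (p : ℚ) : QFFormula G V S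
  | and (φ ψ : QFFormula G V S) : QFFormula G V S
  | or (φ ψ : QFFormula G V S) : QFFormula G V S

namespace QFFormula

/-- Satisfaction of a quantifier-free formula in the structure given by a representation. -/
def Realize {G : Type u} [Group G] {H : Type v} [NormedAddCommGroup H] [InnerProductSpace ℂ H]
    (π : UnitaryRep G H) {V S : Type} (x : V → H) (a : S → ℂ) : QFFormula G V S → Prop
  | le r c p => r.eval (c.eval π x a).down ≤ (p : ℝ)
  | ge r c p => (p : ℝ) ≤ r.eval (c.eval π x a).down
  | and φ ψ => Realize π x a φ ∧ Realize π x a ψ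
  | or φ ψ => Realize π x a φ ∨ Realize π x a ψ

/-- `Approx φ φ'` says that `φ'` is an approximation of `φ`: it arises from `φ` by strictly
relaxing the bound in every atomic formula. -/
inductive Approx {G : Type u} {V S : Type} : QFFormula G V S → QFFormula G V S → Prop
  | le (r : RealPart) (c : RepTerm G V S HSort.scal) (p ε : ℚ) (hε : 0 < ε) :
      Approx (QFFormula.le r c p) (QFFormula.le r c (p + ε))
  | ge (r : RealPart) (c : RepTerm G V S HSort.scal) (p ε : ℚ) (hε : 0 < ε) :
      Approx (QFFormula.ge r c p) (QFFormula.ge r c (p - ε))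
  | and {φ φ' ψ ψ' : QFFormula G V S} (hφ : Approx φ φ') (hψ : Approx ψ ψ') :
      Approx (QFFormula.and φ ψ) (QFFormula.and φ' ψ')
  | or {φ φ' ψ ψ' : QFFormula G V S} (hφ : Approx φ φ') (hψ : Approx ψ ψ') :
      Approx (QFFormula.or φ ψ) (QFFormula.or φ' ψ')

end QFFormula

namespace UnitaryRep

/-- The structure `(H, +, ⟨,⟩, π)` is existentially closed in approximate semantics: whenever a
representation `(K, η)` extends `(H, π)`, every existential formula with parameters in `H` (and in
the scalar sort) that holds in `(K, η)` is such that all its approximations hold in `(H, π)`.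
The extension is given by an equivariant linear isometric embedding `ι`. The quantified variables
are those in the left summands, the parameters are plugged in for those in the right summands. -/
def ExistentiallyClosed {G : Type u} [Group G] {H : Type v} [NormedAddCommGroup H]
    [InnerProductSpace ℂ H] (π : UnitaryRep G H) : Prop :=
  ∀ (K : Type w) [NormedAddCommGroup K] [InnerProductSpace ℂ K] [CompleteSpace K]
    (η : UnitaryRep G K) (ι : H →ₗᵢ[ℂ] K) (_ : ∀ g v, ι (π g v) = η g (ι v))
    (m n k l : ℕ) (v : Fin n → H) (b : Fin l → ℂ)
    (φ φ' : QFFormula G (Fin m ⊕ Fin n) (Fin k ⊕ Fin l)),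
    (∃ (x : Fin m → K) (a : Fin k → ℂ),
      φ.Realize η (Sum.elim x fun i => ι (v i)) (Sum.elim a b)) →
    φ.Approx φ' →
    ∃ (x : Fin m → H) (a : Fin k → ℂ), φ'.Realize π (Sum.elim x v) (Sum.elim a b)

end UnitaryRep

end

/-! Let `σ` on `H` contain infinitely many copies of `λ_G`, and let `η` on `K` extend `σ`. The
complement of `H` in `K` is invariant, so each vector of a tuple in `K` splits as `P i + Q i` with
`P i` in `H`, and the matrix coefficients of the tuple are those of `P` plus those of `Q`. It
suffices to imitate `Q` inside `H`, almost orthogonally to `P`. By amenability there is a finitely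
supported `p` with `⟨λ(g)√p, √p⟩` close to `1` on a given finite set
(`IsAmenableGroup.exists_almost_invariant_sqrt`). By Fell absorption the vectors `√p ⊗ Q i` live in
finitely many copies of `λ_G` (`UnitaryRep.exists_regular_gram`). Moved to later and later copies in
`H`, they become orthogonal to `P` in the limit (`tendsto_inner_shiftedSum`). Parameters have `Q i =
0` and stay fixed. Convergence of matrix coefficients forces convergence of all scalar terms, hence
eventual truth of every approximation (`QFFormula.Approx.eventually_realize`). -/

open scoped Topology InnerProductSpace
open Filter

/-! ### Almost invariant vectors from an invariant mean. -/

/-- Day's convexity argument: in an amenable group the finitely supported probability measures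
include ones that are almost invariant, in `ℓ¹`, under any given finite set of elements. -/
theorem IsAmenableGroup.exists_almost_invariant {G : Type u} [Group G] (hG : IsAmenableGroup G)
    (F : Finset G) {ε : ℝ} (hε : 0 < ε) :
    ∃ p : G →₀ ℝ, (∀ h, 0 ≤ p h) ∧ (p.sum fun _ a => a) = 1 ∧
      ∀ g ∈ F, ∀ T : Finset G, ∑ h ∈ T, |p (g⁻¹ * h) - p h| ≤ ε := by
  classical
  obtain ⟨m, m_one, m_nonneg, m_inv⟩ := hG
  let δ : G → lp (fun _ : G => ℝ) 1 := fun h => lp.single 1 h 1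
  -- `D p` lists the differences between the translates of `p` and `p`; it must be made small in
  -- `ℓ¹` on the convex set `P` below.
  let D : (G →₀ ℝ) →ₗ[ℝ] (F → lp (fun _ : G => ℝ) 1) :=
    Finsupp.linearCombination ℝ fun h g => δ (g * h) - δ h
  have D_single (h : G) : D (Finsupp.single h 1) = fun g : F => δ (g * h) - δ h := by
    simp [D]
  have D_apply (p : G →₀ ℝ) (g : F) (k : G) : D p g k = p ((g : G)⁻¹ * k) - p k := by
    induction p using Finsupp.induction_linear with
    | zero => simp
    | add p q hp hq =>
      rw [map_add, Pi.add_apply, lp.coeFn_add, Pi.add_apply, hp, hq]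
      simp only [Finsupp.add_apply]
      ring
    | single h a =>
      simp only [D, δ, Finsupp.linearCombination_single, Pi.smul_apply, lp.coeFn_smul,
        lp.coeFn_sub, Pi.sub_apply, lp.single_apply, Pi.single_apply, Finsupp.single_apply,
        smul_eq_mul]
      have : k = g * h ↔ h = (g : G)⁻¹ * k := by
        rw [eq_inv_mul_iff_mul_eq, eq_comm]
      simp only [this, eq_comm (a := k)]
      split_ifs <;> simp
  let P : Set (G →₀ ℝ) := {p | (∀ h, 0 ≤ p h) ∧ (p.sum fun _ a => a) = 1}
  have P_convex : Convex ℝ P := by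
    rintro p ⟨hp, hp'⟩ q ⟨hq, hq'⟩ a b ha hb hab
    refine ⟨fun h => ?_, ?_⟩
    · simp only [Finsupp.add_apply, Finsupp.smul_apply, smul_eq_mul]
      exact add_nonneg (mul_nonneg ha (hp h)) (mul_nonneg hb (hq h))
    · have key (r : G →₀ ℝ) :
          (r.sum fun _ a => a) = Finsupp.linearCombination ℝ (fun _ => (1 : ℝ)) r := by
        simp [Finsupp.linearCombination_apply]
      rw [key] at *
      simp [hp', hq', hab]
  have zero_mem : (0 : F → lp (fun _ : G => ℝ) 1) ∈ closure (D '' P) := by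
    by_contra h0
    obtain ⟨f, c, hc, hf⟩ := geometric_hahn_banach_point_closed
      (P_convex.linear_image D).closure isClosed_closure h0
    rw [map_zero] at hc
    -- The separating functional gives bounded functions `ψ g` whose differences with their
    -- translates sum to more than `c > 0` at every point; an invariant mean sends that sum to `0`.
    let ψ : F → G → ℝ := fun g h => f (Pi.single g (δ h))
    have ψ_bound (g : F) (h : G) : ‖ψ g h‖ ≤ ‖f‖ := by
      refine (f.le_opNorm _).trans ?_
      rw [Pi.norm_single]
      simp [δ, lp.norm_single]
    have f_D (h : G) : c < ∑ g, (ψ g (g * h) - ψ g h) := by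
      have h1 := hf _ (subset_closure ⟨Finsupp.single h 1, ⟨fun k => ?_, by simp⟩, rfl⟩)
      · rw [D_single, ← Finset.univ_sum_single (fun g : F => δ (g * h) - δ h), map_sum] at h1
        simpa [ψ, Pi.single_sub] using h1
      · rw [Finsupp.single_apply]; split_ifs <;> simp
    let Ψ : F → lp (fun _ : G => ℝ) ∞ := fun g =>
      ⟨ψ g, memℓp_infty ⟨‖f‖, by rintro _ ⟨h, rfl⟩; exact ψ_bound g h⟩⟩
    let Ψ' : F → lp (fun _ : G => ℝ) ∞ := fun g =>
      ⟨fun h => ψ g (g * h), memℓp_infty ⟨‖f‖, by rintro _ ⟨h, rfl⟩; exact ψ_bound g _⟩⟩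
    have hΨ (g : F) : m (Ψ' g) = m (Ψ g) :=
      m_inv (g : G)⁻¹ (Ψ g) (Ψ' g) fun h => by simp [Ψ, Ψ']
    have h2 := m_nonneg (∑ g, (Ψ' g - Ψ g) - c • 1) fun h => by
      have := (f_D h).le
      simp only [lp.coeFn_sub, lp.coeFn_smul, Pi.sub_apply, lp.coeFn_sum, Finset.sum_apply,
        Pi.smul_apply, lp.infty_coeFn_one, Pi.one_apply, smul_eq_mul, mul_one]
      exact sub_nonneg.2 this
    simp only [map_sub, map_sum, hΨ, sub_self, Finset.sum_const_zero, map_smul, m_one,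
      smul_eq_mul, mul_one] at h2
    linarith
  obtain ⟨_, ⟨p, hp, rfl⟩, hlt⟩ := Metric.mem_closure_iff.1 zero_mem ε hε
  rw [dist_zero_left] at hlt
  refine ⟨p, hp.1, hp.2, fun g hg T => ?_⟩
  have h1 := lp.sum_rpow_le_norm_rpow (p := 1) (by simp) (D p ⟨g, hg⟩) T
  simp only [ENNReal.toReal_one, Real.rpow_one, D_apply, Real.norm_eq_abs] at h1
  exact h1.trans ((norm_le_pi_norm (D p) ⟨g, hg⟩).trans hlt.le)

/-- The coefficient `⟨λ(g)√p, √p⟩` of the regular representation is close to `1` when the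
probability measure `p` is almost invariant under `g`. -/
theorem IsAmenableGroup.exists_almost_invariant_sqrt {G : Type u} [Group G]
    (hG : IsAmenableGroup G) (F : Finset G) {ε : ℝ} (hε : 0 < ε) :
    ∃ p : G →₀ ℝ, (∀ h, 0 ≤ p h) ∧
      ∀ g ∈ F, |∑ h ∈ p.support, √(p (g⁻¹ * h)) * √(p h) - 1| ≤ ε := by
  classical
  obtain ⟨p, hp, hp1, hF⟩ := hG.exists_almost_invariant F hε
  refine ⟨p, hp, fun g hg => ?_⟩
  -- `T` carries both `p` and its translate, so each has mass `1` on it.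
  set T := p.support ∪ p.support.image (g * ·) with hT
  have sum_p : ∑ h ∈ T, p h = 1 := by
    rw [← hp1, Finsupp.sum]
    refine (Finset.sum_subset Finset.subset_union_left fun h _ hh => ?_).symm
    simpa using hh
  have sum_gp : ∑ h ∈ T, p (g⁻¹ * h) = 1 := by
    rw [← hp1, Finsupp.sum]
    trans ∑ h ∈ p.support.image (g * ·), p (g⁻¹ * h)
    · refine (Finset.sum_subset Finset.subset_union_right fun h _ hh => ?_).symm
      by_contra hne
      exact hh (Finset.mem_image.2 ⟨g⁻¹ * h, Finsupp.mem_support_iff.2 hne, by simp⟩)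
    · rw [Finset.sum_image fun a _ b _ hab => mul_left_cancel hab]
      simp
  have sum_sqrt : ∑ h ∈ p.support, √(p (g⁻¹ * h)) * √(p h) =
      ∑ h ∈ T, √(p (g⁻¹ * h)) * √(p h) := by
    refine Finset.sum_subset Finset.subset_union_left fun h _ hh => ?_
    have : p h = 0 := by simpa using hh
    simp [this]
  have upper : ∑ h ∈ T, √(p (g⁻¹ * h)) * √(p h) ≤ ∑ h ∈ T, (p (g⁻¹ * h) + p h) / 2 := by
    refine Finset.sum_le_sum fun h _ => ?_
    nlinarith [sq_nonneg (√(p (g⁻¹ * h)) - √(p h)), Real.sq_sqrt (hp (g⁻¹ * h)),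
      Real.sq_sqrt (hp h)]
  -- The summand on the left is the minimum of the two values, which is at most their geometric
  -- mean.
  have lower : ∑ h ∈ T, ((p (g⁻¹ * h) + p h) / 2 - |p (g⁻¹ * h) - p h| / 2) ≤
      ∑ h ∈ T, √(p (g⁻¹ * h)) * √(p h) := by
    refine Finset.sum_le_sum fun h _ => ?_
    have ha := Real.sqrt_nonneg (p (g⁻¹ * h))
    have hb := Real.sqrt_nonneg (p h)
    have ha2 := Real.mul_self_sqrt (hp (g⁻¹ * h))
    have hb2 := Real.mul_self_sqrt (hp h)
    rcases le_total (√(p (g⁻¹ * h))) (√(p h)) with hab | hab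
    · have := neg_abs_le (p (g⁻¹ * h) - p h)
      have := mul_le_mul_of_nonneg_left hab ha
      linarith
    · have := le_abs_self (p (g⁻¹ * h) - p h)
      have := mul_le_mul_of_nonneg_right hab hb
      linarith
  rw [Finset.sum_sub_distrib, ← Finset.sum_div, ← Finset.sum_div] at lower
  rw [← Finset.sum_div] at upper
  rw [Finset.sum_add_distrib, sum_p, sum_gp] at lower upper
  rw [sum_sqrt, abs_le]
  have := hF g hg T
  constructor <;> linarith

/-! ### Continuity of terms and formulas in the matrix coefficients. -/

section Semantics

variable {G : Type u} [Group G] {H : Type v} [NormedAddCommGroup H] [InnerProductSpace ℂ H]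
  {K : Type w} [NormedAddCommGroup K] [InnerProductSpace ℂ K]

theorem UnitaryRep.mul_apply (π : UnitaryRep G H) (g h : G) (x : H) :
    π (g * h) x = π g (π h x) := by
  rw [map_mul]
  rfl

theorem UnitaryRep.inner_map_right (π : UnitaryRep G H) (g : G) (x y : H) :
    ⟪x, π g y⟫_ℂ = ⟪π g⁻¹ x, y⟫_ℂ := by
  rw [← (π g).inner_map_map (π g⁻¹ x) y, ← π.mul_apply]
  simp

/-- The convergence asserted of the values of a term: for a scalar term, convergence in `ℂ`; for a
vector term, convergence of its matrix coefficients against the variables and against every family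
of vectors whose own matrix coefficients against the variables converge. -/
def RepTerm.EvalTendsto {T : Type*} (l : Filter T) (σ : UnitaryRep G H) (η : UnitaryRep G K)
    {V S : Type} (y : T → V → H) (Y : V → K) (a : S → ℂ) :
    ∀ {s : HSort}, RepTerm G V S s → Prop
  | HSort.vec, s =>
    (∀ g j, Tendsto (fun t => ⟪σ g (s.eval σ (y t) a : H), y t j⟫_ℂ) l
      (𝓝 ⟪η g (s.eval η Y a : K), Y j⟫_ℂ)) ∧
    ∀ (z : T → H) (Z : K),
      (∀ g j, Tendsto (fun t => ⟪σ g (z t), y t j⟫_ℂ) l (𝓝 ⟪η g Z, Y j⟫_ℂ)) →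
      ∀ g, Tendsto (fun t => ⟪σ g (z t), (s.eval σ (y t) a : H)⟫_ℂ) l
        (𝓝 ⟪η g Z, (s.eval η Y a : K)⟫_ℂ)
  | HSort.scal, c =>
    Tendsto (fun t => (c.eval σ (y t) a).down) l (𝓝 (c.eval η Y a).down)

/-- If the Gram data of the variables converge, then so do the values of all terms. -/
theorem RepTerm.evalTendsto {T : Type*} {l : Filter T} {σ : UnitaryRep G H} {η : UnitaryRep G K}
    {V S : Type} {y : T → V → H} {Y : V → K} (a : S → ℂ)
    (hy : ∀ g i j, Tendsto (fun t => ⟪σ g (y t i), y t j⟫_ℂ) l (𝓝 ⟪η g (Y i), Y j⟫_ℂ))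
    {s : HSort} (t : RepTerm G V S s) : t.EvalTendsto l σ η y Y a := by
  induction t with
  | vecVar x => exact ⟨fun g j => hy g x j, fun z Z hz g => hz g x⟩
  | zero =>
    refine ⟨fun g j => ?_, fun z Z hz g => ?_⟩
    · simpa only [RepTerm.eval, map_zero, inner_zero_left] using tendsto_const_nhds
    · simpa only [RepTerm.eval, inner_zero_right] using tendsto_const_nhds
  | vecAdd s t hs ht =>
    refine ⟨fun g j => ?_, fun z Z hz g => ?_⟩
    · simpa only [RepTerm.eval, map_add, inner_add_left] using (hs.1 g j).add (ht.1 g j)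
    · simpa only [RepTerm.eval, inner_add_right] using (hs.2 z Z hz g).add (ht.2 z Z hz g)
  | smul c s hc hs =>
    have hc : Tendsto (fun t => (c.eval σ (y t) a).down) l (𝓝 (c.eval η Y a).down) := hc
    refine ⟨fun g j => ?_, fun z Z hz g => ?_⟩
    · simpa only [RepTerm.eval, map_smul, inner_smul_left, Function.comp_def] using
        ((Complex.continuous_conj.tendsto _).comp hc).mul (hs.1 g j)
    · simpa only [RepTerm.eval, inner_smul_right] using hc.mul (hs.2 z Z hz g)
  | act h s hs =>
    refine ⟨fun g j => ?_, fun z Z hz g => ?_⟩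
    · simpa only [RepTerm.eval, UnitaryRep.mul_apply] using hs.1 (g * h) j
    · simpa only [RepTerm.eval, UnitaryRep.inner_map_right,
        UnitaryRep.mul_apply] using hs.2 z Z hz (h⁻¹ * g)
  | scalVar i => exact tendsto_const_nhds
  | const q => exact tendsto_const_nhds
  | scalAdd c d hc hd => exact Tendsto.add hc hd
  | mul c d hc hd => exact Tendsto.mul hc hd
  | conj c hc => exact (Complex.continuous_conj.tendsto _).comp hc
  | inner s t hs ht =>
    -- Both arguments vary and converge only weakly: the second clause for `t` is tested on the
    -- values of `s`, which are admissible by the first clause for `s`.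
    have := ht.2 _ _ hs.1 1
    simp only [map_one, LinearIsometryEquiv.coe_one, id_eq] at this
    exact this

theorem RealPart.continuous_eval (r : RealPart) : Continuous r.eval := by
  cases r
  · exact Complex.continuous_re
  · exact Complex.continuous_im
  · exact continuous_norm

/-- If the Gram data of the variables converge, then the approximations of a formula that holds
in the limit hold eventually. -/
theorem QFFormula.Approx.eventually_realize {T : Type*} {l : Filter T} {σ : UnitaryRep G H}
    {η : UnitaryRep G K} {V S : Type} {y : T → V → H} {Y : V → K} {a : S → ℂ}
    (hy : ∀ g i j, Tendsto (fun t => ⟪σ g (y t i), y t j⟫_ℂ) l (𝓝 ⟪η g (Y i), Y j⟫_ℂ))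
    {φ φ' : QFFormula G V S} (h : φ.Approx φ') (hφ : φ.Realize η Y a) :
    ∀ᶠ t in l, φ'.Realize σ (y t) a := by
  induction h with
  | le r c p ε hε =>
    have hc := (r.continuous_eval.tendsto _).comp (c.evalTendsto a hy)
    have hlt : r.eval (c.eval η Y a).down < ((p + ε : ℚ) : ℝ) :=
      lt_of_le_of_lt hφ (by exact_mod_cast lt_add_of_pos_right p hε)
    exact (hc.eventually_lt_const hlt).mono fun t ht => le_of_lt ht
  | ge r c p ε hε =>
    have hc := (r.continuous_eval.tendsto _).comp (c.evalTendsto a hy)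
    have hlt : ((p - ε : ℚ) : ℝ) < r.eval (c.eval η Y a).down :=
      lt_of_lt_of_le (by exact_mod_cast sub_lt_self p hε) hφ
    exact (hc.eventually_const_lt hlt).mono fun t ht => le_of_lt ht
  | and _ _ h₁ h₂ => exact (h₁ hφ.1).and (h₂ hφ.2)
  | or _ _ h₁ h₂ =>
    rcases hφ with hφ | hφ
    · exact (h₁ hφ).mono fun _ => Or.inl
    · exact (h₂ hφ).mono fun _ => Or.inr

/-- A representation is existentially closed as soon as the Gram data of tuples in its extensions
can be approximated inside it, keeping the parameters fixed. -/
theorem UnitaryRep.ExistentiallyClosed.of_gram_approx {σ : UnitaryRep G H}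
    (hσ : ∀ (K : Type w) [NormedAddCommGroup K] [InnerProductSpace ℂ K] [CompleteSpace K]
      (η : UnitaryRep G K) (ι : H →ₗᵢ[ℂ] K) (_ : ∀ g v, ι (σ g v) = η g (ι v))
      (m n : ℕ) (v : Fin n → H) (X : Fin m → K) (F : Finset G) (ε : ℝ), 0 < ε →
      ∃ x : Fin m → H, ∀ g ∈ F, ∀ i j,
        dist ⟪σ g (Sum.elim x v i), Sum.elim x v j⟫_ℂ
          ⟪η g (Sum.elim X (fun k => ι (v k)) i), Sum.elim X (fun k => ι (v k)) j⟫_ℂ < ε) :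
    UnitaryRep.ExistentiallyClosed.{u, v, w} σ := by
  classical
  intro K _ _ _ η ι hι m n k l v b φ φ' ⟨X, a, hφ⟩ happ
  -- The approximations form a net indexed by a finite subset of `G` and a tolerance; the scalar
  -- witnesses `a` never change.
  choose x hx using fun t : Finset G × ℕ =>
    hσ K η ι hι m n v X t.1 (1 / ((t.2 : ℝ) + 1)) Nat.one_div_pos_of_nat
  have lim : ∀ g i j, Tendsto (fun t => ⟪σ g (Sum.elim (x t) v i), Sum.elim (x t) v j⟫_ℂ) atTop
      (𝓝 ⟪η g (Sum.elim X (fun k => ι (v k)) i), Sum.elim X (fun k => ι (v k)) j⟫_ℂ) := by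
    intro g i j
    rw [Metric.tendsto_atTop]
    intro ε hε
    obtain ⟨N, hN⟩ := exists_nat_one_div_lt hε
    refine ⟨({g}, N), fun t ht => (hx t g (Finset.singleton_subset_iff.1 ht.1) i j).trans ?_⟩
    refine lt_of_le_of_lt ?_ hN
    exact one_div_le_one_div_of_le (by positivity) (by exact_mod_cast Nat.succ_le_succ ht.2)
  obtain ⟨t, ht⟩ := (happ.eventually_realize lim hφ).exists
  exact ⟨x t, a, ht⟩

end Semantics

/-! ### Fell absorption and weakly null shifts. -/

section Absorption

variable {G : Type u} [Group G]

theorem UnitaryRep.regular_apply (g : G) (f : lp (fun _ : G => ℂ) 2) (h : G) :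
    UnitaryRep.regular G g f h = f (g⁻¹ * h) := rfl

/-- Parseval needs only one of the two vectors in `W`: expand `y` and pair with `x`. In the
application the translated vector may leave `W`. -/
theorem OrthonormalBasis.sum_inner_mul_inner_coe {E : Type*} [NormedAddCommGroup E]
    [InnerProductSpace ℂ E] {W : Submodule ℂ E} {N : Type*} [Fintype N]
    (b : OrthonormalBasis N ℂ W) (x : E) {y : E} (hy : y ∈ W) :
    ∑ n, ⟪x, (b n : E)⟫_ℂ * ⟪(b n : E), y⟫_ℂ = ⟪x, y⟫_ℂ := by
  have h := congrArg (fun w : W => ⟪x, (w : E)⟫_ℂ) (b.sum_repr' ⟨y, hy⟩)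
  simp only [Submodule.coe_inner, Submodule.coe_sum, Submodule.coe_smul, inner_sum,
    inner_smul_right] at h
  rw [← h]
  exact Finset.sum_congr rfl fun n _ => mul_comm _ _

/-- Fell absorption, in coordinates: a finitely supported `p` transports vectors `Q i` of any
representation to finitely many copies of the regular representation, multiplying the matrix
coefficient at `g` by `⟨λ(g)√p, √p⟩`. -/
theorem UnitaryRep.exists_regular_gram {K : Type w} [NormedAddCommGroup K] [InnerProductSpace ℂ K]
    (η : UnitaryRep G K) (p : G →₀ ℝ) {V : Type*} [Finite V] (Q : V → K) :
    ∃ (N : ℕ) (z : V → Fin N → lp (fun _ : G => ℂ) 2), (∀ i, Q i = 0 → z i = 0) ∧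
      ∀ g i j, ∑ n, ⟪UnitaryRep.regular G g (z i n), z j n⟫_ℂ =
        ((∑ h ∈ p.support, √(p (g⁻¹ * h)) * √(p h) : ℝ) : ℂ) * ⟪η g (Q i), Q j⟫_ℂ := by
  classical
  let W : Submodule ℂ K :=
    Submodule.span ℂ (Set.range fun hi : p.support × V => η (hi.1 : G)⁻¹ (Q hi.2))
  have : FiniteDimensional ℂ W := FiniteDimensional.span_of_finite ℂ (Set.finite_range _)
  let b := stdOrthonormalBasis ℂ W
  -- These are the coordinates along `b` of the image of `√p ⊗ Q i` under Fell's unitary `δ_h ⊗ v ↦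
  -- δ_h ⊗ η(h)⁻¹ v`.
  let z : V → Fin (Module.finrank ℂ W) → lp (fun _ : G => ℂ) 2 := fun i n =>
    ⟨fun h => (√(p h) : ℂ) * ⟪(b n : K), η h⁻¹ (Q i)⟫_ℂ,
      (memℓp_zero (p.support.finite_toSet.subset fun h hh => by
        rw [Finset.mem_coe, Finsupp.mem_support_iff]
        rintro h0
        simp [h0] at hh)).of_exponent_ge zero_le⟩
  have z_apply (i n h) : z i n h = (√(p h) : ℂ) * ⟪(b n : K), η h⁻¹ (Q i)⟫_ℂ := rfl
  refine ⟨_, z, fun i hi => ?_, fun g i j => ?_⟩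
  · funext n
    ext h
    simp [z_apply, hi]
  · have inner_eq (n) : ⟪UnitaryRep.regular G g (z i n), z j n⟫_ℂ = ∑ h ∈ p.support,
        ((√(p (g⁻¹ * h)) * √(p h) : ℝ) : ℂ) *
          (⟪η h⁻¹ (η g (Q i)), (b n : K)⟫_ℂ * ⟪(b n : K), η h⁻¹ (Q j)⟫_ℂ) := by
      rw [lp.inner_eq_tsum, tsum_eq_sum (s := p.support) fun h hh => ?_]
      · refine Finset.sum_congr rfl fun h _ => ?_
        rw [UnitaryRep.regular_apply, z_apply, z_apply, RCLike.inner_apply, map_mul,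
          inner_conj_symm, mul_inv_rev, inv_inv, UnitaryRep.mul_apply, Complex.conj_ofReal]
        push_cast
        ring
      · have : p h = 0 := by simpa using hh
        rw [z_apply, this]
        simp
    simp_rw [inner_eq]
    rw [Finset.sum_comm, Complex.ofReal_sum, Finset.sum_mul]
    refine Finset.sum_congr rfl fun h hh => ?_
    -- Unitarity of `η h⁻¹` removes `h` from the inner product, which then factors out of the sum.
    rw [← Finset.mul_sum, b.sum_inner_mul_inner_coe _
      (Submodule.subset_span ⟨(⟨h, hh⟩, j), rfl⟩), LinearIsometryEquiv.inner_map_map]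

variable {E : Type v} [NormedAddCommGroup E]

/-- The vector of the Hilbert sum of copies of `E` with entries `z 0, …, z (N - 1)` in the copies
`M, …, M + N - 1`. -/
noncomputable def shiftedSum {N : ℕ} (M : ℕ) (z : Fin N → E) : lp (fun _ : ℕ => E) 2 :=
  ∑ n : Fin N, lp.single 2 (M + (n : ℕ)) (z n)

theorem shiftedSum_zero {N : ℕ} (M : ℕ) : shiftedSum M (0 : Fin N → E) = 0 := by
  simp [shiftedSum]

theorem shiftedSum_apply {N : ℕ} (M : ℕ) (z : Fin N → E) (n : Fin N) :
    shiftedSum M z (M + (n : ℕ)) = z n := by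
  rw [shiftedSum, lp.coeFn_sum, Finset.sum_apply, Finset.sum_eq_single n]
  · exact lp.single_apply_self ..
  · intro k _ hk
    refine lp.single_apply_ne _ _ _ fun h => hk ?_
    exact Fin.ext (Nat.add_left_cancel h).symm
  · simp

variable [InnerProductSpace ℂ E]

theorem inner_shiftedSum_left {N : ℕ} (M : ℕ) (z : Fin N → E) (f : lp (fun _ : ℕ => E) 2) :
    ⟪shiftedSum M z, f⟫_ℂ = ∑ n : Fin N, ⟪z n, f (M + (n : ℕ))⟫_ℂ := by
  rw [shiftedSum, sum_inner]
  exact Finset.sum_congr rfl fun n _ => lp.inner_single_left _ _ _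

/-- The value does not depend on `M`: shifting preserves Gram data. -/
theorem inner_shiftedSum_shiftedSum {N : ℕ} (M : ℕ) (z z' : Fin N → E) :
    ⟪shiftedSum M z, shiftedSum M z'⟫_ℂ = ∑ n, ⟪z n, z' n⟫_ℂ := by
  simp_rw [inner_shiftedSum_left, shiftedSum_apply]

theorem UnitaryRep.infiniteSum_shiftedSum (π : UnitaryRep G E) (g : G) {N : ℕ} (M : ℕ)
    (z : Fin N → E) :
    π.infiniteSum g (shiftedSum M z) = shiftedSum M fun n => π g (z n) := by
  rw [shiftedSum, map_sum, shiftedSum]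
  refine Finset.sum_congr rfl fun n _ => ?_
  ext k
  change π g (lp.single (E := fun _ : ℕ => E) 2 (M + (n : ℕ)) (z n) k) =
    lp.single (E := fun _ : ℕ => E) 2 (M + (n : ℕ)) (π g (z n)) k
  rcases eq_or_ne k (M + n) with rfl | hk
  · simp only [lp.single_apply_self]
  · rw [lp.single_apply_ne _ _ _ hk, lp.single_apply_ne _ _ _ hk, map_zero]

/-- Shifting a finite tuple of vectors to later and later copies makes it weakly null. -/
theorem tendsto_inner_shiftedSum {N : ℕ} (z : Fin N → E) (f : lp (fun _ : ℕ => E) 2) :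
    Tendsto (fun M => ⟪shiftedSum M z, f⟫_ℂ) atTop (𝓝 0) := by
  have hf : Tendsto (fun k => ‖f k‖) atTop (𝓝 0) := by
    have h := ((lp.memℓp f).summable (by simp)).tendsto_atTop_zero
    simp only [ENNReal.toReal_ofNat, Real.rpow_ofNat] at h
    simpa using h.sqrt
  simp_rw [inner_shiftedSum_left]
  suffices h : ∀ n : Fin N, Tendsto (fun M => ⟪z n, f (M + (n : ℕ))⟫_ℂ) atTop (𝓝 0) by
    simpa only [Finset.sum_const_zero] using
      tendsto_finsetSum (Finset.univ : Finset (Fin N)) fun n _ => h n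
  intro n
  refine squeeze_zero_norm (fun M => norm_inner_le_norm _ _) ?_
  simpa using (hf.comp (tendsto_add_atTop_nat (n : ℕ))).const_mul ‖z n‖

end Absorption

/-! ### Approximating extensions inside the representation. -/

/-- A representation of an amenable group that contains infinitely many copies of the regular
representation is existentially closed. -/
theorem UnitaryRep.ExistentiallyClosed.of_regular_embedding {G : Type u} [Group G]
    (hG : IsAmenableGroup G) {H : Type v} [NormedAddCommGroup H] [InnerProductSpace ℂ H]
    [CompleteSpace H] (σ : UnitaryRep G H)
    (J : lp (fun _ : ℕ => lp (fun _ : G => ℂ) 2) 2 →ₗᵢ[ℂ] H)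
    (hJ : ∀ g f, J ((UnitaryRep.regular G).infiniteSum g f) = σ g (J f)) :
    UnitaryRep.ExistentiallyClosed.{u, v, w} σ := by
  refine .of_gram_approx fun K _ _ _ η ι hι m n v X F ε hε => ?_
  -- As the adjoint of an isometry, `A` is the orthogonal projection onto `ι H`, read in `H`.
  let A := ι.toContinuousLinearMap.adjoint
  let P : Fin m ⊕ Fin n → H := Sum.elim (fun i => A (X i)) v
  let Y : Fin m ⊕ Fin n → K := Sum.elim X fun k => ι (v k)
  let Q : Fin m ⊕ Fin n → K := fun i => Y i - ι (P i)
  have hQ (i) (w : H) : ⟪ι w, Q i⟫_ℂ = 0 := by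
    rcases i with i | i
    · have : ⟪ι w, X i⟫_ℂ = ⟪w, A (X i)⟫_ℂ :=
        (ContinuousLinearMap.adjoint_inner_right ι.toContinuousLinearMap w (X i)).symm
      simp [Q, Y, P, ι.inner_map_map, this]
    · simp [Q, Y, P]
  have hQ' (g i) (w : H) : ⟪η g (Q i), ι w⟫_ℂ = 0 := by
    rw [← inner_conj_symm, UnitaryRep.inner_map_right, ← hι, hQ, map_zero]
  have gram (g i j) : ⟪η g (Y i), Y j⟫_ℂ = ⟪σ g (P i), P j⟫_ℂ + ⟪η g (Q i), Q j⟫_ℂ := by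
    have hY (i) : Y i = ι (P i) + Q i := by simp [Q]
    rw [hY i, hY j, map_add, inner_add_left, inner_add_right, inner_add_right, hQ', ← hι, hQ,
      ι.inner_map_map]
    ring
  obtain ⟨C, hC0, hC⟩ : ∃ C : ℝ, 0 < C ∧ ∀ i j, ‖Q i‖ * ‖Q j‖ ≤ C := by
    obtain ⟨C, hC⟩ := (Set.finite_range fun ij : (Fin m ⊕ Fin n) × (Fin m ⊕ Fin n) =>
      ‖Q ij.1‖ * ‖Q ij.2‖).bddAbove
    exact ⟨max C 1, by positivity,
      fun i j => (hC ⟨(i, j), rfl⟩).trans (le_max_left _ _)⟩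
  -- With `C` bounding the coefficients of `Q`, this tolerance leaves an error of at most `ε / 2`.
  obtain ⟨p, -, hpF⟩ := hG.exists_almost_invariant_sqrt F (ε := ε / (2 * C)) (by positivity)
  obtain ⟨N, z, z_zero, hz⟩ := η.exists_regular_gram p Q
  let c : G → ℝ := fun g => ∑ h ∈ p.support, √(p (g⁻¹ * h)) * √(p h)
  let y : ℕ → Fin m ⊕ Fin n → H := fun M i => P i + J (shiftedSum M (z i))
  have weak (i) (w : H) : Tendsto (fun M => ⟪J (shiftedSum M (z i)), w⟫_ℂ) atTop (𝓝 0) := by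
    have := tendsto_inner_shiftedSum (z i) (J.toContinuousLinearMap.adjoint w)
    simpa only [ContinuousLinearMap.adjoint_inner_right,
      LinearIsometry.coe_toContinuousLinearMap] using this
  have weak' (i) (w : H) : Tendsto (fun M => ⟪w, J (shiftedSum M (z i))⟫_ℂ) atTop (𝓝 0) := by
    have := (Complex.continuous_conj.tendsto _).comp (weak i w)
    simpa only [Function.comp_def, inner_conj_symm, map_zero] using this
  have lim (g i j) : Tendsto (fun M => ⟪σ g (y M i), y M j⟫_ℂ) atTop
      (𝓝 (⟪σ g (P i), P j⟫_ℂ + (c g : ℂ) * ⟪η g (Q i), Q j⟫_ℂ)) := by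
    -- Only the two cross terms depend on `M`, and both are weakly null.
    have expand (M) : ⟪σ g (y M i), y M j⟫_ℂ = ⟪σ g (P i), P j⟫_ℂ +
        (c g : ℂ) * ⟪η g (Q i), Q j⟫_ℂ + ⟪σ g (P i), J (shiftedSum M (z j))⟫_ℂ +
        ⟪J (shiftedSum M (z i)), σ g⁻¹ (P j)⟫_ℂ := by
      rw [← hz, ← inner_shiftedSum_shiftedSum M, ← UnitaryRep.infiniteSum_shiftedSum,
        ← J.inner_map_map, hJ, UnitaryRep.inner_map_right, inv_inv]
      simp only [y, map_add, inner_add_left, inner_add_right]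
      ring
    simp_rw [expand]
    simpa using (tendsto_const_nhds.add (weak' j (σ g (P i)))).add (weak i (σ g⁻¹ (P j)))
  have near (g) (hg : g ∈ F) (i j) :
      dist (⟪σ g (P i), P j⟫_ℂ + (c g : ℂ) * ⟪η g (Q i), Q j⟫_ℂ) ⟪η g (Y i), Y j⟫_ℂ < ε := by
    rw [gram, dist_add_left, dist_eq_norm]
    have h1 : (c g : ℂ) * ⟪η g (Q i), Q j⟫_ℂ - ⟪η g (Q i), Q j⟫_ℂ =
        ((c g - 1 : ℝ) : ℂ) * ⟪η g (Q i), Q j⟫_ℂ := by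
      push_cast
      ring
    have h2 : ‖⟪η g (Q i), Q j⟫_ℂ‖ ≤ C := by
      refine (norm_inner_le_norm _ _).trans ?_
      rw [LinearIsometryEquiv.norm_map]
      exact hC i j
    rw [h1, norm_mul, Complex.norm_real, Real.norm_eq_abs]
    calc |c g - 1| * ‖⟪η g (Q i), Q j⟫_ℂ‖ ≤ ε / (2 * C) * C :=
          mul_le_mul (hpF g hg) h2 (norm_nonneg _) (by positivity)
      _ = ε / 2 := by field_simp
      _ < ε := half_lt_self hε
  have ev : ∀ᶠ M in atTop, ∀ g ∈ F, ∀ i j, dist ⟪σ g (y M i), y M j⟫_ℂ ⟪η g (Y i), Y j⟫_ℂ < ε := by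
    rw [Filter.eventually_all_finset]
    intro g hg
    rw [Filter.eventually_all]
    intro i
    rw [Filter.eventually_all]
    intro j
    exact ((lim g i j).dist tendsto_const_nhds).eventually_lt_const (near g hg i j)
  obtain ⟨M, hM⟩ := ev.exists
  -- Parameters lie in `ι H`, so their `Q`, and with it the correction, vanishes.
  have y_eq : Sum.elim (fun i => y M (Sum.inl i)) v = y M := by
    funext i
    rcases i with i | i
    · rfl
    · have : z (Sum.inr i) = 0 := z_zero _ (by simp [Q, Y, P])
      simp [y, this, shiftedSum_zero, P]
  refine ⟨fun i => y M (Sum.inl i), fun g hg i j => ?_⟩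
  rw [y_eq]
  exact hM g hg i j

theorem mainTheorem1 (G : Type u) [Group G] [Countable G] (hG : IsAmenableGroup G) :
    (∀ (H : Type v) [NormedAddCommGroup H] [InnerProductSpace ℂ H] [CompleteSpace H]
      (π : UnitaryRep G H),
      UnitaryRep.ExistentiallyClosed.{u, max u v, w}
        (π.prod (UnitaryRep.regular G).infiniteSum)) ∧
    UnitaryRep.ExistentiallyClosed.{u, u, w} (UnitaryRep.regular G).infiniteSum := by
  refine ⟨fun H _ _ _ π => ?_, ?_⟩
  · let J : lp (fun _ : ℕ => lp (fun _ : G => ℂ) 2) 2 →ₗᵢ[ℂ]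
        WithLp 2 (H × lp (fun _ : ℕ => lp (fun _ : G => ℂ) 2) 2) :=
      { toLinearMap := (WithLp.linearEquiv 2 ℂ _).symm.toLinearMap ∘ₗ LinearMap.inr ℂ H _
        norm_map' := fun f => WithLp.norm_toLp_snd .. }
    refine .of_regular_embedding hG _ J fun g f => ?_
    refine congrArg (WithLp.toLp 2) (Prod.ext ?_ rfl)
    exact (map_zero (π g)).symm
  · exact .of_regular_embedding hG _ LinearIsometry.id fun g f => rfl
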